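/- Let $p$ be a prime, let $|\cdot|_p$ be the $p$-adic absolute value, extended to an algebraic closure $\overline{\mathbb{Q}}_p$, and let $\log x=\sum_{n\ge 1}(-1)^{n-1}(x-1)^n/n$ for $|x-1|_p<1$. **Definitions.** For points $\mathbf v=(v_1:v_2)$, $\mathbf w=(w_1:w_2)$ of $\mathbf{P}^1_{\overline{\mathbb{Q}}_p}$ put $$d(\mathbf v,\mathbf w)=\frac{|v_1w_2-v_2w_1|_p}{\max\{|v_1|_p,|v_2|_p\}\cdot\max\{|w_1|_p,|w_2|_p\}},$$ and regard $\mathbf{P}^1_{\mathbb{Q}_p}$ as a subset of $\mathbf{P}^1_{\overline{\mathbb{Q}}_p}$. For $N\ge 1$ let $\mathbb{A}_N=\{1,\dots,N\}$. For $w=a_1a_2\dots\in\mathbb{A}_N^{\mathbb{N}}$ and $\mathbf q\in \mathbf{P}^1_{\mathbb{Q}_p}$ let $\mathrm{T}(w,\mathbf q)=(a_2a_3\dots,\,A_{a_1}\mathbf q)$, where $A_a=\begin{pmatrix}0&1\\1&a\end{pmatrix}$. For $\mathbf x=(w,\mathbf x_p)$ let $\mathbf x_{p,n}$ be the second component of $\mathrm{T}^n\mathbf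 x$ ($n\ge 0$), and let $$B_k(\mathbf x)=\{\mathbf q\in\mathbf{P}^1_{\mathbb{Q}_p}:\ \exists\, n\ge 0,\ d(\mathbf q,\mathbf x_{p,n})\le p^{-k}\}.$$ For $\epsilon>0$ let $\mathbf{PBad}_\epsilon$ be the set of $(q_1:q_2)\in\mathbf{P}^1_{\mathbb{Q}_p}$ with $$\frac{|aq_1+bq_2|_p}{\max\{|q_1|_p,|q_2|_p\}}\ge\frac{\epsilon}{\max\{a^2,b^2\}}\quad\text{for all }(a,b)\in\mathbb{Z}^2\setminus\{(0,0)\},$$ and let $\mathbf{LMad}_\epsilon$ be the set of pairs $\mathbf x$ with $\mathrm{T}^n\mathbf x\in\mathbb{A}_{M}^{\mathbb{N}}\times\mathbf{PBad}_\epsilon$ for all $n\ge 0$, where $M=[\epsilon^{-1}]+1$. For a matrix $A\in\mathrm{SL}_2^{\pm}(\mathbb{Z}_p)$ (that is, with entries in $\mathbb{Z}_p$ and $\det A=\pm1$) having two different eigenvectors in $\mathbf{P}^1_{\overline{\mathbb{Q}}_p}$, let $\kappa(A)$ be a positive integer with $\kappa(A)\le p^2$ and $|\lambda^{\kappa(A)}-1|_p\le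 p^{-1}$ for each eigenvalue $\lambda$ of $A$ (such an integer always exists; any choice is allowed). Let $\widetilde{\mathrm{SL}}_2(\mathbb{Z}_p)$ be the set of those $A$ for which $\log\lambda^{\kappa(A)}\ne0$ for each eigenvalue $\lambda$ of $A$. **Theorem.** Let $A\in\widetilde{\mathrm{SL}}_2(\mathbb{Z}_p)$, let $\mathbf w_1\neq\mathbf w_2$ be the two eigenvectors of $A^T$ in $\mathbf{P}^1_{\overline{\mathbb{Q}}_p}$, and let $\lambda_1$ be one of the eigenvalues of $A$. Let $\mathbf x=(w,\mathbf x_p)\in\mathbb{A}_N^{\mathbb{N}}\times\mathbf{P}^1_{\mathbb{Q}_p}$ for some $N\geq 1$, and define $$\epsilon_1=d(\mathbf x_p,\mathbf w_1),\quad \epsilon_2=d(\mathbf x_p,\mathbf w_2),\quad \epsilon_3=\left|\log\left(\lambda_1^{4\kappa(A)}\right)\right|_p,\quad \delta=\min\{\epsilon_1,\epsilon_2,p^{-1}\}.$$ Assume that $\delta\ne0$. Let $m\ge1$ and $k\ge0$ be integers with $$p^k\ge\frac{\sqrt{d(\mathbf w_1,\mathbf w_2)\cdot m}}{\epsilon_3\cdot\delta\cdot\sqrt{2\epsilon_1\epsilon_2\cdot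 p\cdot\kappa(A)}}.$$ If $$\{\mathbf x_p,\ A^T\mathbf x_p,\ \dots,\ (A^T)^m\mathbf x_p\}\subset B_k(\mathbf x),$$ then $\mathbf x\notin\mathbf{LMad}_\epsilon$ for $$\epsilon=\sqrt{\frac{2\epsilon_1\epsilon_2\cdot p\cdot\kappa(A)}{\epsilon_3^2\,\delta^2\cdot d(\mathbf w_1,\mathbf w_2)\cdot m}}.$$ -/

import Mathlib

open scoped LinearAlgebra.Projectivization

noncomputable section

/-- The projective line over a field `K`, in homogeneous coordinates `(x 0, x 1)`. -/
abbrev ProjLine (K : Type*) [Field K] : Type _ := ℙ K (Fin 2 → K)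

section Metric

variable {K : Type*} [NormedField K]

/-- `max (|x 0|, |x 1|)`; note `min (|x 0|⁻¹, |x 1|⁻¹) = 1 / vecHeight x` with `0⁻¹ = ∞`. -/
def vecHeight (x : Fin 2 → K) : ℝ := max ‖x 0‖ ‖x 1‖

/-- The distance `|v₀ w₁ - v₁ w₀| / (max(|v₀|,|v₁|) max(|w₀|,|w₁|))` on the projective line. -/
def projDist (v w : ProjLine K) : ℝ :=
  ‖v.rep 0 * w.rep 1 - v.rep 1 * w.rep 0‖ / (vecHeight v.rep * vecHeight w.rep)

theorem vecHeight_smul (c : K) (x : Fin 2 → K) : vecHeight (c • x) = ‖c‖ * vecHeight x := by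
  simp [vecHeight, mul_max_of_nonneg]

/-- `projDist` can be computed from any choice of homogeneous coordinates. -/
theorem projDist_mk (v w : Fin 2 → K) (hv : v ≠ 0) (hw : w ≠ 0) :
    projDist (.mk K v hv) (.mk K w hw) =
      ‖v 0 * w 1 - v 1 * w 0‖ / (vecHeight v * vecHeight w) := by
  obtain ⟨a, ha⟩ := Projectivization.exists_smul_eq_mk_rep K v hv
  obtain ⟨b, hb⟩ := Projectivization.exists_smul_eq_mk_rep K w hw
  have ha0 : ‖(a : K)‖ ≠ 0 := by simp
  have hb0 : ‖(b : K)‖ ≠ 0 := by simp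
  have e : (a : K) * v 0 * ((b : K) * w 1) - (a : K) * v 1 * ((b : K) * w 0)
      = (a : K) * b * (v 0 * w 1 - v 1 * w 0) := by ring
  rw [projDist, ← ha, ← hb, Units.smul_def, Units.smul_def, vecHeight_smul, vecHeight_smul]
  simp only [Pi.smul_apply, smul_eq_mul]
  rw [e, norm_mul, norm_mul,
    show ‖(a : K)‖ * vecHeight v * (‖(b : K)‖ * vecHeight w)
      = ‖(a : K)‖ * ‖(b : K)‖ * (vecHeight v * vecHeight w) by ring]
  exact mul_div_mul_left _ _ (mul_ne_zero ha0 hb0)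

end Metric

section Matrices

variable {R : Type*} [CommRing R]

/-- The transpose of an invertible `2 × 2` matrix. -/
def glTranspose (A : Matrix.GeneralLinearGroup (Fin 2) R) : Matrix.GeneralLinearGroup (Fin 2) R where
  val := (A : Matrix (Fin 2) (Fin 2) R).transpose
  inv := ((A⁻¹ : Matrix.GeneralLinearGroup (Fin 2) R) : Matrix (Fin 2) (Fin 2) R).transpose
  val_inv := by rw [← Matrix.transpose_mul, ← Units.val_mul, inv_mul_cancel]; simp
  inv_val := by rw [← Matrix.transpose_mul, ← Units.val_mul, mul_inv_cancel]; simp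

/-- The matrix `(0 1; 1 a)`, attached to the partial quotient `a`. -/
def cfMatrix (R : Type*) [CommRing R] (a : ℕ) : Matrix.GeneralLinearGroup (Fin 2) R where
  val := !![0, 1; 1, (a : R)]
  inv := !![-(a : R), 1; 1, 0]
  val_inv := by simp [Matrix.one_fin_two]
  inv_val := by simp [Matrix.one_fin_two]

end Matrices

section Shift

variable (p : ℕ) [Fact p.Prime]

/-- The extended shift `(a₁a₂…, q) ↦ (a₂a₃…, A_{a₁} q)`; the first letter of `w` is `w 0`. -/
def extShift (x : (ℕ → ℕ) × ProjLine ℚ_[p]) : (ℕ → ℕ) × ProjLine ℚ_[p] :=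
  (fun i => x.1 (i + 1), cfMatrix ℚ_[p] (x.1 0) • x.2)

/-- The infinite words over the alphabet `{1, …, N}`. -/
def boundedWords (N : ℕ) : Set (ℕ → ℕ) := {w | ∀ i, 1 ≤ w i ∧ w i ≤ N}

/-- The `p`-adically badly approximable points with constant `ε`: for all integers
`(a, b) ≠ (0, 0)`, `|a q₁ + b q₂|_p / max (|q₁|_p, |q₂|_p) ≥ ε / max (a², b²)`. -/
def PBad (ε : ℝ) : Set (ProjLine ℚ_[p]) :=
  {q | ∀ a b : ℤ, (a, b) ≠ (0, 0) →
    ε / max ((a : ℝ) ^ 2) ((b : ℝ) ^ 2) ≤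
      ‖(a : ℚ_[p]) * q.rep 0 + (b : ℚ_[p]) * q.rep 1‖ / vecHeight q.rep}

/-- The set `LMad_ε`: the whole forward orbit stays in `𝔸_N^ℕ × PBad_ε`, `N = ⌊ε⁻¹⌋ + 1`. -/
def LMad (ε : ℝ) : Set ((ℕ → ℕ) × ProjLine ℚ_[p]) :=
  {x | ∀ n : ℕ, ((extShift p)^[n] x).1 ∈ boundedWords (⌊ε⁻¹⌋₊ + 1) ∧
    ((extShift p)^[n] x).2 ∈ PBad p ε}

/-- `B_k(x)`: the `p^{-k}`-neighbourhood of the points `x_{p,n}`, the second components of the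
orbit of `x`. -/
def orbitNhd (k : ℕ) (x : (ℕ → ℕ) × ProjLine ℚ_[p]) : Set (ProjLine ℚ_[p]) :=
  {q | ∃ n : ℕ, projDist q ((extShift p)^[n] x).2 ≤ ((p : ℝ) ^ k)⁻¹}

end Shift

section AlgebraicClosure

variable (p : ℕ) [Fact p.Prime]

/-- Coordinatewise inclusion `ℚ_p² → (ℚ̄_p)²`. -/
def vecToAlgCl : (Fin 2 → ℚ_[p]) →ₛₗ[algebraMap ℚ_[p] (PadicAlgCl p)] (Fin 2 → PadicAlgCl p) where
  toFun v i := algebraMap ℚ_[p] (PadicAlgCl p) (v i)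
  map_add' v w := by ext i; simp
  map_smul' c v := by ext i; simp

theorem vecToAlgCl_injective : Function.Injective (vecToAlgCl p) := fun v w h => by
  ext i
  exact (algebraMap ℚ_[p] (PadicAlgCl p)).injective (congrFun h i)

/-- The inclusion of the projective line over `ℚ_p` in the one over `ℚ̄_p`. -/
def projToAlgCl : ProjLine ℚ_[p] → ProjLine (PadicAlgCl p) :=
  Projectivization.map (vecToAlgCl p) (vecToAlgCl_injective p)

/-- The `p`-adic logarithm `∑_{n ≥ 1} (-1)^{n-1} (x-1)^n / n`, used for `|x - 1|_p < 1`. -/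
def padicLog (x : PadicAlgCl p) : PadicAlgCl p :=
  ∑' n : ℕ, (-1) ^ n * (x - 1) ^ (n + 1) / ((n : PadicAlgCl p) + 1)

variable {p}

/-- The matrix over `ℚ_p` defined by a matrix over `ℤ_p`. -/
def toPadicGL (A : Matrix.GeneralLinearGroup (Fin 2) ℤ_[p]) :
    Matrix.GeneralLinearGroup (Fin 2) ℚ_[p] :=
  Matrix.GeneralLinearGroup.map PadicInt.Coe.ringHom A

/-- The endomorphism of `(ℚ̄_p)²` defined by a matrix over `ℤ_p`. -/
def algClEnd (A : Matrix.GeneralLinearGroup (Fin 2) ℤ_[p]) :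
    Module.End (PadicAlgCl p) (Fin 2 → PadicAlgCl p) :=
  Matrix.toLin' ((A : Matrix (Fin 2) (Fin 2) ℤ_[p]).map
    fun a => algebraMap ℚ_[p] (PadicAlgCl p) (a : ℚ_[p]))

/-- `w`, a point of the projective line over `ℚ̄_p`, is an eigenvector of `A`. -/
def IsEigenpoint (A : Matrix.GeneralLinearGroup (Fin 2) ℤ_[p]) (w : ProjLine (PadicAlgCl p)) :
    Prop :=
  ∃ μ : PadicAlgCl p, (algClEnd A).HasEigenvector μ w.rep

/-- `κ` is an admissible value of `κ(A)`: a positive integer, at most `p²`, such that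
`|λ^κ - 1|_p ≤ p⁻¹` for each eigenvalue `λ` of `A`. -/
def IsKappa (A : Matrix.GeneralLinearGroup (Fin 2) ℤ_[p]) (κ : ℕ) : Prop :=
  0 < κ ∧ κ ≤ p ^ 2 ∧
    ∀ μ : PadicAlgCl p, (algClEnd A).HasEigenvalue μ → ‖μ ^ κ - 1‖ ≤ (p : ℝ)⁻¹

/-- The set `SL₂^±(ℤ_p)` of matrices of determinant `±1`. -/
def SLpm (p : ℕ) [Fact p.Prime] : Set (Matrix.GeneralLinearGroup (Fin 2) ℤ_[p]) :=
  {A | (A : Matrix (Fin 2) (Fin 2) ℤ_[p]).det = 1 ∨ (A : Matrix (Fin 2) (Fin 2) ℤ_[p]).det = -1}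

/-- The matrices in `SL₂^±(ℤ_p)` with two different eigenvectors in the projective line
over `ℚ̄_p`. -/
def SLpmOne (p : ℕ) [Fact p.Prime] : Set (Matrix.GeneralLinearGroup (Fin 2) ℤ_[p]) :=
  {A | A ∈ SLpm p ∧ ∃ w₁ w₂, w₁ ≠ w₂ ∧ IsEigenpoint A w₁ ∧ IsEigenpoint A w₂}

/-- Membership of `A` in the set `S̃L₂(ℤ_p)`, where `κ` is the value of `κ(A)`. -/
def MemSLTilde (A : Matrix.GeneralLinearGroup (Fin 2) ℤ_[p]) (κ : ℕ) : Prop :=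
  A ∈ SLpmOne p ∧
    ∀ μ : PadicAlgCl p, (algClEnd A).HasEigenvalue μ → padicLog p (μ ^ κ) ≠ 0

end AlgebraicClosure

end

/-! ### Powers of elements close to 1 -/

section PadicAnalysis

/-! Suppose the pair lies in `LMad p ε`. Represent `xp` by a primitive integral vector `v` and let
`M` be the transpose of `A`. Expanding `v` in the eigenvectors of `M` shows that the determinant of
`M^(2κt) v` and `M^(2κs) v` has absolute value exactly `ρ |t - s|`, with `ρ = ε₁ ε₂ ε₃ / d(w₁, w₂)`
(`norm_wedge_pow_mulVec`). Indeed the exponent `2κ` makes the powers of the two eigenvalues inverse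
to each other, so their separation is governed by `lam^(4κ) - 1`, and near 1 the logarithm preserves
the distance to 1 (`norm_padicLog`), so this has absolute value `ε₃`.

Write `ρ = p^(-l₀)` and `l = max l₀ 1`. Along exponents `2κ p^(l - l₀) t` the coordinate ratios
differ by exactly `p^(-l) |t - t'|`. They lie in one class mod `p^l`, and for `t < p^s` they exhaust
its refinements mod `p^(l+s)`. So one of them is congruent mod `p^(l+s)` to an integer `0 ≤ c <
p^l`, which gives an integral form with coefficients `c, -1`, of size at most `p^(-(l+s))` there
(`exists_int_form_small`).

If `l + s ≤ k`, the form is equally small at a nearby point of the orbit of `x`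
(`IsPrimitiveVec.norm_form_div_le`), whereas bad approximability forces a value above `ε p^(-2l) ≥ ε
(ε₃ δ)^2`. This is absurd once `p^(l+s) ≥ 1 / (ε (ε₃ δ)^2)`. For the least such `l + s`, the choice
of `ε` keeps the exponents at most `m`, and the hypothesis on `k` gives `l + s ≤ k`. -/

theorem norm_natCast_of_normedAlgebra (p : ℕ) [Fact p.Prime] {K : Type*} [NormedField K]
    [NormedAlgebra ℚ_[p] K] (n : ℕ) : ‖(n : K)‖ = ‖(n : ℚ_[p])‖ := by
  rw [← norm_algebraMap' K (n : ℚ_[p]), map_natCast]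

theorem norm_natCast_le_one_of_normedAlgebra (p : ℕ) [Fact p.Prime] {K : Type*} [NormedField K]
    [NormedAlgebra ℚ_[p] K] (n : ℕ) : ‖(n : K)‖ ≤ 1 := by
  rw [norm_natCast_of_normedAlgebra p]
  exact_mod_cast Padic.norm_int_le_one (p := p) n

/-- The `p`-part of `n` divides `n`, hence is at most `n`. This bounds the denominators in the
binomial and logarithm series. -/
theorem one_le_mul_norm_natCast (p : ℕ) [Fact p.Prime] {K : Type*} [NormedField K]
    [NormedAlgebra ℚ_[p] K] {n : ℕ} (hn : n ≠ 0) : 1 ≤ (n : ℝ) * ‖(n : K)‖ := by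
  have hp : (0 : ℝ) < p := mod_cast (Fact.out : p.Prime).pos
  rw [norm_natCast_of_normedAlgebra p, Padic.norm_eq_zpow_neg_valuation (mod_cast hn),
    Padic.valuation_natCast, zpow_neg, zpow_natCast, ← div_eq_mul_inv, one_le_div (by positivity)]
  exact_mod_cast Nat.le_of_dvd (Nat.pos_of_ne_zero hn) pow_padicValNat_dvd

/-- This is why the radius 1/3 is used throughout: the higher terms stay below the linear one by a
uniform factor, for every `p`. -/
theorem add_two_mul_inv_three_pow_le (k : ℕ) : ((k : ℝ) + 2) * (1 / 3) ^ (k + 1) ≤ 2 / 3 := by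
  induction k with
  | zero => norm_num
  | succ k ih =>
    have h : (0 : ℝ) < (1 / 3) ^ (k + 1) := by positivity
    rw [pow_succ]
    push_cast
    nlinarith [(Nat.cast_nonneg k : (0 : ℝ) ≤ k)]

theorem norm_add_eq_right_of_norm_le {K : Type*} [NormedField K] [IsUltrametricDist K] {s v : K} (h : ‖s‖ ≤ 2 / 3 * ‖v‖) : ‖s + v‖ = ‖v‖ := by
  rcases eq_or_ne v 0 with rfl | hv
  · simp only [norm_zero, mul_zero, norm_le_zero_iff] at h
    simp [h]
  · have hv' : 0 < ‖v‖ := norm_pos_iff.mpr hv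
    rw [IsUltrametricDist.norm_add_eq_max_of_norm_ne_norm (by linarith), max_eq_right (by linarith)]

/-- In the binomial expansion the linear term `n u` strictly dominates all later ones, so the
ultrametric inequality is an equality. -/
theorem norm_one_add_pow_sub_one (p : ℕ) [Fact p.Prime] {K : Type*} [NormedField K]
    [NormedAlgebra ℚ_[p] K] [IsUltrametricDist K] {u : K} (hu : ‖u‖ ≤ 1 / 3) (n : ℕ) :
    ‖(1 + u) ^ n - 1‖ = ‖(n : K)‖ * ‖u‖ := by
  rcases n with _ | N
  · simp
  have e : (1 + u) ^ (N + 1) - 1 =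
      ∑ k ∈ Finset.range N, u ^ (k + 2) * ((N + 1).choose (k + 2) : K) + ((N + 1 : ℕ) : K) * u := by
    rw [add_comm 1 u, add_pow, Finset.sum_range_succ', Finset.sum_range_succ']
    simp
    ring
  rw [e, norm_add_eq_right_of_norm_le, norm_mul]
  refine IsUltrametricDist.norm_sum_le_of_forall_le_of_nonneg (by positivity) fun k _ => ?_
  -- Absorption extracts the factor `|N + 1|` from each higher binomial coefficient, at the cost of
  -- `1 / |k + 2| ≤ k + 2`.
  have h1 : ((N + 1 : ℕ) : K) * (N.choose (k + 1) : K) =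
      ((N + 1).choose (k + 2) : K) * ((k + 2 : ℕ) : K) := by
    rw [← Nat.cast_mul, ← Nat.cast_mul, Nat.add_one_mul_choose_eq]
  have h2 : ‖((N + 1).choose (k + 2) : K)‖ ≤ ‖((N + 1 : ℕ) : K)‖ * ((k : ℝ) + 2) := by
    have h3 := one_le_mul_norm_natCast p (K := K) (n := k + 2) (by omega)
    have h4 : ‖((N + 1 : ℕ) : K)‖ * ‖(N.choose (k + 1) : K)‖ =
      ‖((N + 1).choose (k + 2) : K)‖ * ‖((k + 2 : ℕ) : K)‖ := by rw [← norm_mul, h1, norm_mul]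
    have h5 := norm_natCast_le_one_of_normedAlgebra p (K := K) (N.choose (k + 1))
    calc _ ≤ ‖((N + 1).choose (k + 2) : K)‖ * (((k + 2 : ℕ) : ℝ) * ‖((k + 2 : ℕ) : K)‖) :=
          le_mul_of_one_le_right (norm_nonneg _) h3
      _ = (‖((N + 1 : ℕ) : K)‖ * ‖(N.choose (k + 1) : K)‖) * (k + 2) := by
          rw [h4]; push_cast; ring
      _ ≤ _ := by
          gcongr
          exact mul_le_of_le_one_right (norm_nonneg _) h5
  rw [norm_mul, norm_pow, norm_mul]
  calc ‖u‖ ^ (k + 2) * ‖((N + 1).choose (k + 2) : K)‖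
      ≤ (‖u‖ * (1 / 3) ^ (k + 1)) * (‖((N + 1 : ℕ) : K)‖ * ((k : ℝ) + 2)) := by
        rw [pow_succ' ‖u‖ (k + 1)]; gcongr
    _ = (((k : ℝ) + 2) * (1 / 3) ^ (k + 1)) * (‖((N + 1 : ℕ) : K)‖ * ‖u‖) := by ring
    _ ≤ _ := by gcongr; exact add_two_mul_inv_three_pow_le k

end PadicAnalysis

/-! ### The logarithm near 1 -/

section PadicLog

variable {p : ℕ} [Fact p.Prime]

theorem norm_padicLog_term_le (u : PadicAlgCl p) (n : ℕ) :
    ‖(-1) ^ n * u ^ (n + 1) / ((n : PadicAlgCl p) + 1)‖ ≤ ((n : ℝ) + 1) * ‖u‖ ^ (n + 1) := by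
  have h := one_le_mul_norm_natCast p (K := PadicAlgCl p) (n := n + 1) (by omega)
  push_cast at h
  have h0 : 0 < ‖(n : PadicAlgCl p) + 1‖ := norm_pos_iff.mpr (Nat.cast_add_one_ne_zero n)
  rw [norm_div, norm_mul, norm_pow, norm_neg, norm_one, one_pow, one_mul, norm_pow,
    div_le_iff₀ h0]
  nlinarith [pow_nonneg (norm_nonneg u) (n + 1)]

theorem summable_padicLog {x : PadicAlgCl p} (hx : ‖x - 1‖ < 1) :
    Summable fun n : ℕ => (-1) ^ n * (x - 1) ^ (n + 1) / ((n : PadicAlgCl p) + 1) := by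
  set u := x - 1
  -- The algebraic closure is not complete, but all terms lie in the finite-dimensional, hence
  -- complete, space `ℚ_p[u]`.
  let S := Subalgebra.toSubmodule (Algebra.adjoin ℚ_[p] {u})
  have : FiniteDimensional ℚ_[p] S :=
    Module.Finite.iff_fg.mpr (Algebra.IsIntegral.isIntegral u).fg_adjoin_singleton
  have : CompleteSpace S := FiniteDimensional.complete ℚ_[p] S
  have hmem (n : ℕ) : (-1) ^ n * u ^ (n + 1) / ((n : PadicAlgCl p) + 1) ∈ S := by
    have e : (-1) ^ n * u ^ (n + 1) / ((n : PadicAlgCl p) + 1) =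
        ((-1) ^ n / ((n : ℚ_[p]) + 1)) • u ^ (n + 1) := by
      rw [Algebra.smul_def]; simp; ring
    rw [e]
    exact S.smul_mem _ (pow_mem (Algebra.self_mem_adjoin_singleton ℚ_[p] u) _)
  let f : ℕ → S := fun n => ⟨_, hmem n⟩
  have hf : Summable f := by
    refine Summable.of_norm_bounded (g := fun n : ℕ => ((n : ℝ) + 1) * ‖u‖ ^ (n + 1)) ?_
      fun n => norm_padicLog_term_le u n
    have := summable_pow_mul_geometric_of_norm_lt_one 1 (r := ‖u‖) (by simpa using hx)
    simpa using (summable_nat_add_iff 1).mpr this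
  exact hf.map S.subtype continuous_subtype_val

/-- The first term of the series dominates the rest, by the same estimate as for powers. -/
theorem norm_padicLog {x : PadicAlgCl p} (hx : ‖x - 1‖ ≤ 1 / 3) : ‖padicLog p x‖ = ‖x - 1‖ := by
  have hs := summable_padicLog (x := x) (by linarith)
  rw [padicLog, hs.tsum_eq_zero_add, add_comm]
  have e : (-1) ^ 0 * (x - 1) ^ (0 + 1) / (((0 : ℕ) : PadicAlgCl p) + 1) = x - 1 := by simp
  rw [e]
  refine norm_add_eq_right_of_norm_le ?_
  refine IsUltrametricDist.norm_tsum_le_of_forall_le_of_nonneg (by positivity) fun n => ?_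
  refine (norm_padicLog_term_le _ _).trans ?_
  push_cast
  calc ((n : ℝ) + 1 + 1) * ‖x - 1‖ ^ (n + 1 + 1)
      ≤ ((n : ℝ) + 2) * (‖x - 1‖ * (1 / 3) ^ (n + 1)) := by
        rw [pow_succ' ‖x - 1‖ (n + 1), add_assoc, one_add_one_eq_two]; gcongr
    _ = (((n : ℝ) + 2) * (1 / 3) ^ (n + 1)) * ‖x - 1‖ := by ring
    _ ≤ _ := by gcongr; exact add_two_mul_inv_three_pow_le n

theorem padicLog_one : padicLog p 1 = 0 := by
  rw [← norm_eq_zero, norm_padicLog] <;> simp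

end PadicLog

/-! ### The vanishing of log(-1) for p = 2 -/

section TwoAdic

open Filter Topology

theorem tendsto_choose_two_pow_sub_one (k : ℕ) :
    Tendsto (fun n : ℕ => (((2 ^ n - 1).choose k : ℕ) : ℚ_[2])) atTop (𝓝 ((-1) ^ k)) := by
  induction k with
  | zero => simp
  | succ k ih =>
    have h2 : Tendsto (fun n : ℕ => (2 : ℚ_[2]) ^ n) atTop (𝓝 0) := by
      refine tendsto_pow_atTop_nhds_zero_of_norm_lt_one ?_
      have := Padic.norm_p_lt_one (p := 2)
      simpa using this
    have e (n : ℕ) : (((2 ^ n - 1).choose (k + 1) : ℕ) : ℚ_[2]) =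
        (2 : ℚ_[2]) ^ n * ((2 ^ n - 1).choose k : ℕ) / ((k : ℚ_[2]) + 1) -
          ((2 ^ n - 1).choose k : ℕ) := by
      obtain ⟨N, hN⟩ : ∃ N, 2 ^ n = N + 1 := ⟨2 ^ n - 1, by have := Nat.one_le_two_pow (n := n); omega⟩
      have hN' : (2 : ℚ_[2]) ^ n = N + 1 := by exact_mod_cast hN
      have h1 : ((N : ℚ_[2]) + 1) * (N.choose k : ℕ) = ((N + 1).choose (k + 1) : ℕ) * ((k : ℚ_[2]) + 1) := by
        exact_mod_cast Nat.add_one_mul_choose_eq N k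
      rw [hN, hN', Nat.add_sub_cancel, h1, Nat.choose_succ_succ]
      have : (k : ℚ_[2]) + 1 ≠ 0 := Nat.cast_add_one_ne_zero k
      field_simp
      simp
    simp_rw [e]
    convert ((h2.mul ih).div_const ((k : ℚ_[2]) + 1)).sub ih using 2
    ring

/-- By absorption the sum is `((1 + u)^(N+1) - 1) / (N + 1)`. -/
theorem tsum_choose_mul_pow_div {u : ℚ_[2]} (N : ℕ) (hu : (1 + u) ^ (N + 1) = 1) :
    ∑' k : ℕ, ((N.choose k : ℕ) : ℚ_[2]) * u ^ (k + 1) / ((k : ℚ_[2]) + 1) = 0 := by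
  have hN0 : ((N : ℚ_[2]) + 1) ≠ 0 := Nat.cast_add_one_ne_zero N
  have e : (1 + u) ^ (N + 1) - 1 =
      ∑ k ∈ Finset.range (N + 1), u ^ (k + 1) * ((N + 1).choose (k + 1) : ℚ_[2]) := by
    rw [add_comm 1 u, add_pow, Finset.sum_range_succ']
    simp
  rw [tsum_eq_sum (s := Finset.range (N + 1)) fun k hk => by
    rw [Nat.choose_eq_zero_of_lt (by simpa using hk)]; simp]
  rw [← mul_right_inj' hN0, mul_zero, ← sub_eq_zero.mpr hu, e, Finset.mul_sum]
  refine Finset.sum_congr rfl fun k _ => ?_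
  have h1 : ((N : ℚ_[2]) + 1) * (N.choose k : ℕ) =
      ((N + 1).choose (k + 1) : ℕ) * ((k : ℚ_[2]) + 1) := by
    exact_mod_cast Nat.add_one_mul_choose_eq N k
  have : (k : ℚ_[2]) + 1 ≠ 0 := Nat.cast_add_one_ne_zero k
  field_simp
  linear_combination u ^ (k + 1) * h1

theorem tendsto_tsum_mul_pow_div {u : ℚ_[2]} (h2 : ‖u‖ = 1 / 2) {c : ℕ → ℕ → ℚ_[2]} {d : ℕ → ℚ_[2]}
    (hc : ∀ n k, ‖c n k‖ ≤ 1) (hd : ∀ k, ‖d k‖ ≤ 1)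
    (hlim : ∀ k, Tendsto (fun n => c n k) atTop (𝓝 (d k))) :
    Summable (fun k : ℕ => d k * u ^ (k + 1) / ((k : ℚ_[2]) + 1)) ∧
    Tendsto (fun n => ∑' k : ℕ, c n k * u ^ (k + 1) / ((k : ℚ_[2]) + 1)) atTop
      (𝓝 (∑' k : ℕ, d k * u ^ (k + 1) / ((k : ℚ_[2]) + 1))) := by
  have hbound : Summable fun n : ℕ => ((n : ℝ) + 1) * ‖u‖ ^ (n + 1) := by
    have := summable_pow_mul_geometric_of_norm_lt_one 1 (r := ‖u‖) (by rw [h2]; norm_num)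
    simpa using (summable_nat_add_iff 1).mpr this
  have hterm (n : ℕ) (c : ℚ_[2]) (hc : ‖c‖ ≤ 1) :
      ‖c * u ^ (n + 1) / ((n : ℚ_[2]) + 1)‖ ≤ ((n : ℝ) + 1) * ‖u‖ ^ (n + 1) := by
    have h := one_le_mul_norm_natCast 2 (K := ℚ_[2]) (n := n + 1) (by omega)
    push_cast at h
    have h0 : 0 < ‖(n : ℚ_[2]) + 1‖ := norm_pos_iff.mpr (Nat.cast_add_one_ne_zero n)
    rw [norm_div, norm_mul, norm_pow, div_le_iff₀ h0]
    have h3 := pow_nonneg (norm_nonneg u) (n + 1)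
    calc ‖c‖ * ‖u‖ ^ (n + 1) ≤ 1 * ‖u‖ ^ (n + 1) := by gcongr
      _ ≤ (((n : ℝ) + 1) * ‖(n : ℚ_[2]) + 1‖) * ‖u‖ ^ (n + 1) := by gcongr
      _ = _ := by ring
  exact ⟨Summable.of_norm_bounded hbound fun n => hterm n _ (hd n),
    tendsto_tsum_of_dominated_convergence hbound
      (fun k => ((hlim k).mul_const _).div_const _)
      (Eventually.of_forall fun n k => hterm k _ (hc n k))⟩

/-- The logarithm of `1 + u` is the limit of `((1 + u)^(2^n) - 1) / 2^n`: expanded in powers of `u`,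
these quotients converge termwise to the logarithm series under a summable bound. For `1 + u = -1`
they vanish when `n > 0`. -/
theorem hasSum_log_neg_one {u : ℚ_[2]} (hu : 1 + u = -1) :
    HasSum (fun n : ℕ => (-1) ^ n * u ^ (n + 1) / ((n : ℚ_[2]) + 1)) 0 := by
  have h2 : ‖u‖ = 1 / 2 := by
    have h := Padic.norm_p (p := 2)
    rw [show u = -((2 : ℕ) : ℚ_[2]) by push_cast; linear_combination hu, norm_neg, h]
    norm_num
  obtain ⟨hs, hlim⟩ := tendsto_tsum_mul_pow_div h2
    (c := fun n k => (((2 ^ n - 1).choose k : ℕ) : ℚ_[2])) (d := fun k => (-1) ^ k)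
    (fun n k => norm_natCast_le_one_of_normedAlgebra 2 (K := ℚ_[2]) _) (by simp)
    tendsto_choose_two_pow_sub_one
  have hzero : ∀ᶠ n : ℕ in atTop,
      ∑' k : ℕ, (((2 ^ n - 1).choose k : ℕ) : ℚ_[2]) * u ^ (k + 1) / ((k : ℚ_[2]) + 1) = 0 := by
    filter_upwards [eventually_gt_atTop 0] with n hn
    obtain ⟨N, hN⟩ : ∃ N, 2 ^ n = N + 1 := ⟨2 ^ n - 1, by have := Nat.one_le_two_pow (n := n); omega⟩
    rw [hN, Nat.add_sub_cancel]
    refine tsum_choose_mul_pow_div N ?_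
    rw [← hN, hu, Even.neg_one_pow ((Nat.even_pow' hn.ne').mpr even_two)]
  have h0 : Tendsto (fun _ : ℕ => (0 : ℚ_[2])) atTop
      (𝓝 (∑' k : ℕ, (-1) ^ k * u ^ (k + 1) / ((k : ℚ_[2]) + 1))) :=
    Tendsto.congr' hzero hlim
  rw [tendsto_nhds_unique tendsto_const_nhds h0]
  exact hs.hasSum

theorem padicLog_two_neg_one : padicLog 2 (-1) = 0 := by
  have h := (hasSum_log_neg_one (u := -1 - 1) (by norm_num)).map (algebraMap ℚ_[2] (PadicAlgCl 2))
    (continuous_algebraMap ℚ_[2] (PadicAlgCl 2))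
  rw [map_zero] at h
  rw [padicLog, ← h.tsum_eq]
  refine tsum_congr fun n => ?_
  simp

end TwoAdic

/-! ### Determinants of plane vectors and eigenvectors -/

section Wedge

/-- The determinant of two plane vectors. -/
def wedge {R : Type*} [CommRing R] (v w : Fin 2 → R) : R := v 0 * w 1 - v 1 * w 0

variable {R : Type*} [CommRing R]

theorem map_wedge {S : Type*} [CommRing S] (f : R →+* S) (v w : Fin 2 → R) :
    f (wedge v w) = wedge (fun i => f (v i)) (fun i => f (w i)) := by
  simp [wedge]

theorem wedge_smul_eq (a u₁ u₂ : Fin 2 → R) :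
    wedge u₁ u₂ • a = wedge a u₂ • u₁ - wedge a u₁ • u₂ := by
  ext i
  fin_cases i <;> simp [wedge] <;> ring

theorem pow_mulVec_of_mulVec_eq_smul {M : Matrix (Fin 2) (Fin 2) R} {u : Fin 2 → R} {μ : R}
    (h : M.mulVec u = μ • u) (i : ℕ) : (M ^ i).mulVec u = μ ^ i • u := by
  induction i with
  | zero => simp
  | succ i ih => rw [pow_succ, ← Matrix.mulVec_mulVec, h, Matrix.mulVec_smul, ih, smul_smul, pow_succ']

/-- By Cramer's rule `wedge u₁ u₂ • a` is a combination of the eigenvectors, on which powers of `M`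
act diagonally. -/
theorem wedge_mul_wedge_pow_mulVec [IsDomain R] {M : Matrix (Fin 2) (Fin 2) R} {u₁ u₂ : Fin 2 → R}
    {μ₁ μ₂ : R} (h₁ : M.mulVec u₁ = μ₁ • u₁) (h₂ : M.mulVec u₂ = μ₂ • u₂) (hu : wedge u₁ u₂ ≠ 0)
    (a : Fin 2 → R) (i j : ℕ) :
    wedge u₁ u₂ * wedge ((M ^ i).mulVec a) ((M ^ j).mulVec a) =
      wedge a u₁ * wedge a u₂ * (μ₁ ^ j * μ₂ ^ i - μ₁ ^ i * μ₂ ^ j) := by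
  have key (i : ℕ) : wedge u₁ u₂ • (M ^ i).mulVec a =
      (wedge a u₂ * μ₁ ^ i) • u₁ - (wedge a u₁ * μ₂ ^ i) • u₂ := by
    rw [← Matrix.mulVec_smul, wedge_smul_eq, Matrix.mulVec_sub, Matrix.mulVec_smul,
      Matrix.mulVec_smul, pow_mulVec_of_mulVec_eq_smul h₁, pow_mulVec_of_mulVec_eq_smul h₂,
      smul_smul, smul_smul]
  refine mul_left_cancel₀ hu ?_
  have e : wedge u₁ u₂ * (wedge u₁ u₂ * wedge ((M ^ i).mulVec a) ((M ^ j).mulVec a)) =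
      wedge (wedge u₁ u₂ • (M ^ i).mulVec a) (wedge u₁ u₂ • (M ^ j).mulVec a) := by
    simp only [wedge, Pi.smul_apply, smul_eq_mul]; ring
  rw [e, key, key]
  generalize wedge a u₁ = x
  generalize wedge a u₂ = y
  simp only [wedge, Pi.smul_apply, Pi.sub_apply, smul_eq_mul]
  ring

theorem det_eq_mul_of_mulVec_eq_smul [IsDomain R] {M : Matrix (Fin 2) (Fin 2) R} {u₁ u₂ : Fin 2 → R}
    {μ₁ μ₂ : R} (h₁ : M.mulVec u₁ = μ₁ • u₁) (h₂ : M.mulVec u₂ = μ₂ • u₂)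
    (hu : wedge u₁ u₂ ≠ 0) : M.det = μ₁ * μ₂ ∧ M.trace = μ₁ + μ₂ := by
  have a0 := congrFun h₁ 0
  have a1 := congrFun h₁ 1
  have b0 := congrFun h₂ 0
  have b1 := congrFun h₂ 1
  simp only [Matrix.mulVec_fin_two, Matrix.cons_val_zero, Matrix.cons_val_one, Pi.smul_apply,
    smul_eq_mul] at a0 a1 b0 b1
  constructor
  · refine mul_left_cancel₀ hu ?_
    rw [Matrix.det_fin_two, wedge]
    linear_combination a0 * (M 1 0 * u₂ 0 + M 1 1 * u₂ 1) - a1 * (M 0 0 * u₂ 0 + M 0 1 * u₂ 1)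
      + μ₁ * u₁ 0 * b1 - μ₁ * u₁ 1 * b0
  · refine mul_left_cancel₀ hu ?_
    rw [Matrix.trace_fin_two, wedge]
    linear_combination a0 * u₂ 1 - a1 * u₂ 0 + u₁ 0 * b1 - u₁ 1 * b0

theorem sq_sub_trace_mul_add_det_eq_zero [IsDomain R] {M : Matrix (Fin 2) (Fin 2) R}
    {u : Fin 2 → R} {μ : R} (h : M.mulVec u = μ • u) (hu : u ≠ 0) :
    μ ^ 2 - M.trace * μ + M.det = 0 := by
  have a0 := congrFun h 0
  have a1 := congrFun h 1
  simp only [Matrix.mulVec_fin_two, Matrix.cons_val_zero, Matrix.cons_val_one, Pi.smul_apply,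
    smul_eq_mul] at a0 a1
  rw [Matrix.det_fin_two, Matrix.trace_fin_two]
  by_contra hne
  refine hu ?_
  have h0 : u 0 = 0 := by
    refine (mul_eq_zero.mp (?_ : _ * u 0 = 0)).resolve_left hne
    linear_combination (M 1 1 - μ) * a0 - M 0 1 * a1
  have h1 : u 1 = 0 := by
    refine (mul_eq_zero.mp (?_ : _ * u 1 = 0)).resolve_left hne
    linear_combination (M 0 0 - μ) * a1 - M 1 0 * a0
  ext i
  fin_cases i <;> simp [h0, h1]

end Wedge

/-! ### The ultrametric on the projective line -/

section ProjectiveMetric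

variable {K : Type*} [NormedField K]

theorem vecHeight_pos {x : Fin 2 → K} (hx : x ≠ 0) : 0 < vecHeight x := by
  by_contra h
  have h1 := max_le_iff.mp (not_lt.mp h)
  refine hx ?_
  ext i
  fin_cases i
  · simpa using h1.1
  · simpa using h1.2

theorem projDist_eq_wedge (v w : ProjLine K) :
    projDist v w = ‖wedge v.rep w.rep‖ / (vecHeight v.rep * vecHeight w.rep) := rfl

theorem wedge_rep_ne_zero {v w : ProjLine K} (h : v ≠ w) : wedge v.rep w.rep ≠ 0 := by
  intro h0
  refine h ?_
  rw [← v.mk_rep, ← w.mk_rep, Projectivization.mk_eq_mk_iff']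
  have hv := v.rep_nonzero
  have hw := w.rep_nonzero
  set a := v.rep
  set b := w.rep
  simp only [wedge] at h0
  by_cases hb : b 0 = 0
  · have hb1 : b 1 ≠ 0 := fun hb1 => hw (by ext i; fin_cases i <;> simp [hb, hb1])
    refine ⟨a 1 / b 1, ?_⟩
    rw [hb, mul_zero, sub_zero] at h0
    have ha : a 0 = 0 := (mul_eq_zero.mp h0).resolve_right hb1
    ext i
    fin_cases i <;> simp [hb, ha, hb1]
  · refine ⟨a 0 / b 0, ?_⟩
    ext i
    fin_cases i
    · simp [hb]
    · simp only [Fin.mk_one, Pi.smul_apply, smul_eq_mul]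
      field_simp
      linear_combination h0

theorem projDist_pos {v w : ProjLine K} (h : v ≠ w) : 0 < projDist v w := by
  rw [projDist_eq_wedge]
  exact div_pos (norm_pos_iff.mpr (wedge_rep_ne_zero h))
    (mul_pos (vecHeight_pos v.rep_nonzero) (vecHeight_pos w.rep_nonzero))

theorem projDist_nonneg (v w : ProjLine K) : 0 ≤ projDist v w := by
  rw [projDist_eq_wedge]
  exact div_nonneg (norm_nonneg _)
    (mul_pos (vecHeight_pos v.rep_nonzero) (vecHeight_pos w.rep_nonzero)).le

/-- Take norms coordinatewise in the Cramer identity `wedge_smul_eq`. -/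
theorem projDist_le_max [IsUltrametricDist K] (x v w : ProjLine K) :
    projDist v w ≤ max (projDist x v) (projDist x w) := by
  have hx := vecHeight_pos x.rep_nonzero
  have hv := vecHeight_pos v.rep_nonzero
  have hw := vecHeight_pos w.rep_nonzero
  simp only [projDist_eq_wedge]
  set a := x.rep
  set b := v.rep
  set c := w.rep
  have hnorm (y : Fin 2 → K) (i : Fin 2) : ‖y i‖ ≤ vecHeight y := by
    fin_cases i
    · exact le_max_left _ _
    · exact le_max_right _ _
  have key (i : Fin 2) : ‖wedge b c‖ * ‖a i‖ ≤
      max (‖wedge a b‖ * vecHeight c) (‖wedge a c‖ * vecHeight b) := by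
    have e := congrFun (wedge_smul_eq a b c) i
    simp only [Pi.smul_apply, Pi.sub_apply, smul_eq_mul] at e
    rw [← norm_mul, e, sub_eq_add_neg, max_comm]
    refine (IsUltrametricDist.norm_add_le_max _ _).trans ?_
    rw [norm_neg, norm_mul, norm_mul]
    exact max_le_max (by gcongr; exact hnorm _ _) (by gcongr; exact hnorm _ _)
  have key' : ‖wedge b c‖ * vecHeight a ≤
      max (‖wedge a b‖ * vecHeight c) (‖wedge a c‖ * vecHeight b) := by
    rw [vecHeight, mul_max_of_nonneg _ _ (norm_nonneg _)]
    exact max_le (key 0) (key 1)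
  rcases le_max_iff.mp key' with h | h
  · refine le_max_of_le_left ?_
    rw [div_le_div_iff₀ (by positivity) (by positivity)]
    nlinarith
  · refine le_max_of_le_right ?_
    rw [div_le_div_iff₀ (by positivity) (by positivity)]
    nlinarith

end ProjectiveMetric

/-! ### Powers of the eigenvalues -/

section EigenvaluePowers

variable {p : ℕ} [Fact p.Prime]

/-- The fourth power is needed for `p = 2`, where `1/p` exceeds the radius 1/3. There `y^4 = 1`
leaves only `y = 1` and `y = -1`, both with zero logarithm. -/
theorem norm_pow_four_sub_one_le {y : PadicAlgCl p} (hy : ‖y - 1‖ ≤ (p : ℝ)⁻¹) :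
    ‖y ^ 4 - 1‖ ≤ 1 / 3 ∧ (padicLog p y ≠ 0 → y ^ 4 ≠ 1) := by
  obtain ⟨u, rfl⟩ : ∃ u, y = 1 + u := ⟨y - 1, by ring⟩
  rw [add_sub_cancel_left] at hy
  have hp := (Fact.out : p.Prime)
  rcases hp.two_le.eq_or_lt with rfl | hp3
  · have h2 : ‖(2 : PadicAlgCl 2)‖ = 1 / 2 := by
      have := norm_natCast_of_normedAlgebra 2 (K := PadicAlgCl 2) 2
      rw [Padic.norm_p] at this
      simpa using this
    -- The first squaring brings the element within radius 1/3, so the second one is covered by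
    -- `norm_one_add_pow_sub_one`.
    have hsq : ‖(1 + u) ^ 2 - 1‖ ≤ 1 / 4 := by
      rw [show (1 + u) ^ 2 - 1 = u * (2 + u) by ring, norm_mul]
      have h3 : ‖2 + u‖ ≤ 1 / 2 :=
        (IsUltrametricDist.norm_add_le_max _ _).trans (max_le h2.le (by simpa using hy))
      have h4 : ‖u‖ ≤ 1 / 2 := by simpa using hy
      nlinarith [norm_nonneg u, norm_nonneg (2 + u)]
    have e : (1 + u) ^ 4 = (1 + ((1 + u) ^ 2 - 1)) ^ 2 := by ring
    have hfour := norm_one_add_pow_sub_one 2 (u := (1 + u) ^ 2 - 1) (by linarith) 2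
    rw [← e] at hfour
    refine ⟨by rw [hfour]; push_cast; rw [h2]; linarith [norm_nonneg ((1 + u) ^ 2 - 1)], ?_⟩
    intro hlog h1
    rw [h1, sub_self, norm_zero, eq_comm, mul_eq_zero, norm_eq_zero, norm_eq_zero] at hfour
    have hs : (1 + u) ^ 2 = 1 := sub_eq_zero.mp (hfour.resolve_left (by simp))
    rcases mul_self_eq_one_iff.mp ((sq _).symm.trans hs) with h | h
    · exact hlog (by rw [h, padicLog_one])
    · exact hlog (by rw [h, padicLog_two_neg_one])
  · have h3 : ‖u‖ ≤ 1 / 3 := by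
      refine hy.trans ?_
      rw [one_div]
      exact inv_anti₀ (by norm_num) (by exact_mod_cast hp3)
    have hfour := norm_one_add_pow_sub_one p h3 4
    have h4 := norm_natCast_le_one_of_normedAlgebra p (K := PadicAlgCl p) 4
    refine ⟨by rw [hfour]; exact (mul_le_of_le_one_left (norm_nonneg u) h4).trans h3, ?_⟩
    intro hlog h1
    rw [h1, sub_self, norm_zero, eq_comm, mul_eq_zero, norm_eq_zero, norm_eq_zero] at hfour
    have hs : u = 0 := hfour.resolve_left (by simp)
    exact hlog (by rw [hs, add_zero, padicLog_one])

/-- Since `Q` is the inverse of the unit `P`, the difference for `t = s + n` is `Q^n ((P^2)^n - 1)`.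
-/
theorem norm_pow_mul_pow_sub {P Q : PadicAlgCl p} (hPQ : P * Q = 1) (hP : ‖P ^ 2 - 1‖ ≤ 1 / 3)
    (t s : ℕ) :
    ‖P ^ t * Q ^ s - P ^ s * Q ^ t‖ = ‖(t : ℚ_[p]) - s‖ * ‖P ^ 2 - 1‖ := by
  wlog h : s ≤ t generalizing t s
  · rw [norm_sub_rev, this s t (by omega), norm_sub_rev]
  obtain ⟨n, rfl⟩ := Nat.exists_eq_add_of_le h
  have hP1 : ‖P‖ = 1 := by
    have h1 : ‖P ^ 2‖ = 1 := by
      have := norm_add_eq_right_of_norm_le (s := P ^ 2 - 1) (v := 1) (by rw [norm_one]; linarith)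
      simpa using this
    rwa [norm_pow, pow_eq_one_iff_of_nonneg (norm_nonneg _) two_ne_zero] at h1
  have hQ1 : ‖Q‖ = 1 := by
    have := congrArg norm hPQ
    rwa [norm_mul, hP1, one_mul, norm_one] at this
  have e : P ^ (s + n) * Q ^ s - P ^ s * Q ^ (s + n) = Q ^ n * ((1 + (P ^ 2 - 1)) ^ n - 1) := by
    have e1 : P ^ s * Q ^ s = 1 := by rw [← mul_pow, hPQ, one_pow]
    have e2 : P ^ n * Q ^ n = 1 := by rw [← mul_pow, hPQ, one_pow]
    rw [add_sub_cancel, ← pow_mul, two_mul, pow_add, pow_add, pow_add]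
    linear_combination (P ^ n - Q ^ n) * e1 - P ^ n * e2
  rw [e, norm_mul, norm_pow, hQ1, one_pow, one_mul, norm_one_add_pow_sub_one p hP,
    norm_natCast_of_normedAlgebra p]
  simp

end EigenvaluePowers

/-! ### Primitive integral coordinates -/

noncomputable section

section Primitive

variable {p : ℕ} [Fact p.Prime]

/-- A vector over `ℤ_p` is primitive when one of its coordinates is a unit. -/
def IsPrimitiveVec (v : Fin 2 → ℤ_[p]) : Prop := ‖v 0‖ = 1 ∨ ‖v 1‖ = 1

/-- The inclusion `ℤ_p² → ℚ_p²`. -/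
def vecToPadic (v : Fin 2 → ℤ_[p]) : Fin 2 → ℚ_[p] := fun i => (v i : ℚ_[p])

theorem IsPrimitiveVec.vecHeight_eq {v : Fin 2 → ℤ_[p]} (hv : IsPrimitiveVec v) :
    vecHeight (vecToPadic v) = 1 := by
  refine le_antisymm (max_le (v 0).norm_le_one (v 1).norm_le_one) ?_
  rcases hv with h | h
  · exact h.symm.le.trans (le_max_left ‖v 0‖ ‖v 1‖)
  · exact h.symm.le.trans (le_max_right ‖v 0‖ ‖v 1‖)

theorem IsPrimitiveVec.vecToPadic_ne_zero {v : Fin 2 → ℤ_[p]} (hv : IsPrimitiveVec v) :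
    vecToPadic v ≠ 0 := by
  intro h
  have := hv.vecHeight_eq
  rw [h] at this
  simp [vecHeight] at this

/-- The point of the projective line defined by a primitive vector. -/
def IsPrimitiveVec.point {v : Fin 2 → ℤ_[p]} (hv : IsPrimitiveVec v) : ProjLine ℚ_[p] :=
  .mk ℚ_[p] (vecToPadic v) hv.vecToPadic_ne_zero

theorem exists_isPrimitiveVec_point_eq (x : ProjLine ℚ_[p]) :
    ∃ (v : Fin 2 → ℤ_[p]) (hv : IsPrimitiveVec v), hv.point = x := by
  have hx := x.rep_nonzero
  obtain ⟨i, hi, hle⟩ : ∃ i, x.rep i ≠ 0 ∧ ∀ j, ‖x.rep j‖ ≤ ‖x.rep i‖ := by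
    obtain ⟨i, hi⟩ := Finite.exists_max fun i => ‖x.rep i‖
    refine ⟨i, fun h0 => hx ?_, hi⟩
    ext j
    have := hi j
    rwa [h0, norm_zero, norm_le_zero_iff] at this
  let v : Fin 2 → ℤ_[p] := fun j => ⟨x.rep j / x.rep i, by
    rw [norm_div]; exact div_le_one_of_le₀ (hle j) (norm_nonneg _)⟩
  have hvi : ‖v i‖ = 1 := by
    change ‖x.rep i / x.rep i‖ = 1
    rw [div_self hi, norm_one]
  have hv : IsPrimitiveVec v := by
    fin_cases i
    · exact Or.inl hvi
    · exact Or.inr hvi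
  refine ⟨v, hv, ?_⟩
  rw [IsPrimitiveVec.point]
  conv_rhs => rw [← x.mk_rep]
  rw [Projectivization.mk_eq_mk_iff']
  refine ⟨(x.rep i)⁻¹, ?_⟩
  ext j
  change (x.rep i)⁻¹ * x.rep j = x.rep j / x.rep i
  rw [div_eq_inv_mul]

theorem IsPrimitiveVec.mulVec {v : Fin 2 → ℤ_[p]} (hv : IsPrimitiveVec v)
    (B : Matrix.GeneralLinearGroup (Fin 2) ℤ_[p]) :
    IsPrimitiveVec ((B : Matrix (Fin 2) (Fin 2) ℤ_[p]).mulVec v) := by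
  by_contra h
  obtain ⟨h0, h1⟩ := not_or.mp h
  set u := (B : Matrix (Fin 2) (Fin 2) ℤ_[p]).mulVec v
  have hu : ((B⁻¹ : Matrix.GeneralLinearGroup (Fin 2) ℤ_[p]) :
      Matrix (Fin 2) (Fin 2) ℤ_[p]).mulVec u = v := by
    rw [Matrix.mulVec_mulVec, ← Units.val_mul, inv_mul_cancel, Units.val_one, Matrix.one_mulVec]
  have h0' : ‖u 0‖ < 1 := lt_of_le_of_ne (u 0).norm_le_one h0
  have h1' : ‖u 1‖ < 1 := lt_of_le_of_ne (u 1).norm_le_one h1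
  have hlt (i : Fin 2) : ‖v i‖ < 1 := by
    rw [← hu]
    simp only [Matrix.mulVec, dotProduct, Fin.sum_univ_two]
    exact PadicInt.norm_lt_one_add (PadicInt.norm_lt_one_mul h0') (PadicInt.norm_lt_one_mul h1')
  rcases hv with h | h
  · exact (hlt 0).ne h
  · exact (hlt 1).ne h

theorem IsPrimitiveVec.toPadicGL_smul_point {v : Fin 2 → ℤ_[p]} (hv : IsPrimitiveVec v)
    (B : Matrix.GeneralLinearGroup (Fin 2) ℤ_[p]) :
    toPadicGL B • hv.point = (hv.mulVec B).point := by
  rw [IsPrimitiveVec.point, IsPrimitiveVec.point, Projectivization.smul_mk]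
  congr 1

/-- If `v 0` is a unit, `v 0` times the form at `c = y.rep` equals `c 0` times the form at `v` plus
`b` times the determinant of `v` and `c`. Integers have norm at most 1, so both terms are small. The
case of `v 1` is symmetric. -/
theorem IsPrimitiveVec.norm_form_div_le {v : Fin 2 → ℤ_[p]} (hv : IsPrimitiveVec v)
    {y : ProjLine ℚ_[p]} {r : ℝ} (hy : projDist hv.point y ≤ r) {a b : ℤ}
    (hab : ‖(a : ℤ_[p]) * v 0 + b * v 1‖ ≤ r) :
    ‖(a : ℚ_[p]) * y.rep 0 + b * y.rep 1‖ / vecHeight y.rep ≤ r := by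
  have hH := vecHeight_pos y.rep_nonzero
  rw [IsPrimitiveVec.point] at hy
  conv at hy => lhs; rw [← y.mk_rep]
  rw [projDist_mk, hv.vecHeight_eq, one_mul, div_le_iff₀ hH] at hy
  rw [div_le_iff₀ hH]
  set c := y.rep
  have hr : 0 ≤ r := (norm_nonneg _).trans hab
  have hform : ‖(a : ℚ_[p]) * vecToPadic v 0 + b * vecToPadic v 1‖ ≤ r := by
    rw [PadicInt.norm_def] at hab
    simpa [vecToPadic] using hab
  have bound (c' : ℚ_[p]) (n : ℤ) (hc' : ‖c'‖ ≤ vecHeight c) :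
      ‖c' * ((a : ℚ_[p]) * vecToPadic v 0 + b * vecToPadic v 1) +
        n * (vecToPadic v 0 * c 1 - vecToPadic v 1 * c 0)‖ ≤ r * vecHeight c := by
    refine (IsUltrametricDist.norm_add_le_max _ _).trans (max_le ?_ ?_)
    · rw [norm_mul, mul_comm r]
      gcongr
    · rw [norm_mul]
      exact (mul_le_of_le_one_left (norm_nonneg _) (Padic.norm_int_le_one n)).trans hy
  rcases hv with h | h
  · have h' : ‖vecToPadic v 0‖ = 1 := h
    calc _ = ‖vecToPadic v 0 * ((a : ℚ_[p]) * c 0 + b * c 1)‖ := by rw [norm_mul, h', one_mul]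
      _ = _ := by congr 1; ring
      _ ≤ _ := bound (c 0) b (le_max_left _ _)
  · have h' : ‖vecToPadic v 1‖ = 1 := h
    calc _ = ‖vecToPadic v 1 * ((a : ℚ_[p]) * c 0 + b * c 1)‖ := by rw [norm_mul, h', one_mul]
      _ = ‖c 1 * ((a : ℚ_[p]) * vecToPadic v 0 + b * vecToPadic v 1) +
        (-a : ℤ) * (vecToPadic v 0 * c 1 - vecToPadic v 1 * c 0)‖ := by
          congr 1; push_cast; ring
      _ ≤ _ := bound (c 1) (-a) (le_max_right _ _)

end Primitive

/-! ### Small integral forms by counting residues -/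

section Pigeonhole

variable {p : ℕ} [Fact p.Prime]

/-- All `z t` share their lowest `l` digits. The next `s` digits separate the `p^s` indices, so
every pattern of them occurs, including zero. The corresponding `z t` is then congruent mod
`p^(l+s)` to the number `c` formed by the common digits. -/
theorem exists_norm_sub_natCast_le {z : ℕ → ℤ_[p]} {l s : ℕ}
    (hz : ∀ t t', ‖z t - z t'‖ = (p : ℝ) ^ (-l : ℤ) * ‖(t : ℚ_[p]) - t'‖) :
    ∃ c < p ^ l, ∃ t < p ^ s, ‖z t - c‖ ≤ (p : ℝ) ^ (-(l + s : ℕ) : ℤ) := by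
  have hp : 0 < p := (Fact.out : p.Prime).pos
  have hp0 : (0 : ℝ) < p := mod_cast hp
  have happr (t n : ℕ) : ‖z t - (z t).appr n‖ ≤ (p : ℝ) ^ (-n : ℤ) :=
    (PadicInt.norm_le_pow_iff_mem_span_pow _ _).mpr (PadicInt.appr_spec n (z t))
  have hmod (t : ℕ) : (z t).appr (l + s) % p ^ l = (z 0).appr l := by
    have h1 : ‖(((z t).appr (l + s) : ℤ) - ((z 0).appr l : ℤ) : ℤ_[p])‖ ≤ (p : ℝ) ^ (-l : ℤ) := by
      have e : (((z t).appr (l + s) : ℤ) - ((z 0).appr l : ℤ) : ℤ_[p]) =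
          (-(z t - (z t).appr (l + s)) + (z t - z 0)) + (z 0 - (z 0).appr l) := by
        push_cast; ring
      rw [e]
      refine (IsUltrametricDist.norm_add_le_max _ _).trans (max_le ?_ (happr 0 l))
      refine (IsUltrametricDist.norm_add_le_max _ _).trans (max_le ?_ ?_)
      · rw [norm_neg]
        refine (happr t (l + s)).trans (zpow_le_zpow_right₀ ?_ (by push_cast; omega))
        exact_mod_cast hp
      · rw [hz]
        refine mul_le_of_le_one_right (by positivity) ?_
        exact_mod_cast Padic.norm_int_le_one (p := p) ((t : ℤ) - (0 : ℕ))
    rw [← Int.cast_sub, PadicInt.norm_int_le_pow_iff_dvd] at h1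
    have h2 := (Nat.modEq_iff_dvd (n := p ^ l)).mpr (by exact_mod_cast h1)
    have h3 : (z 0).appr l % p ^ l = (z t).appr (l + s) % p ^ l := h2
    rw [← h3, Nat.mod_eq_of_lt (PadicInt.appr_lt _ _)]
  let f : Fin (p ^ s) → Fin (p ^ s) := fun t => ⟨(z t).appr (l + s) / p ^ l, by
    rw [Nat.div_lt_iff_lt_mul (by positivity), ← pow_add, add_comm s l]
    exact PadicInt.appr_lt _ _⟩
  have hf : Function.Injective f := by
    intro t t' h
    have h1 : (z t).appr (l + s) / p ^ l = (z t').appr (l + s) / p ^ l := congrArg Fin.val h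
    have h2 : (z t).appr (l + s) = (z t').appr (l + s) := by
      rw [← Nat.div_add_mod ((z t).appr (l + s)) (p ^ l),
        ← Nat.div_add_mod ((z t').appr (l + s)) (p ^ l), hmod, hmod, h1]
    have h3 : ‖z t - z t'‖ ≤ (p : ℝ) ^ (-(l + s : ℕ) : ℤ) := by
      have e : z t - z t' = (z t - (z t).appr (l + s)) + -(z t' - (z t').appr (l + s)) := by
        rw [h2]; ring
      rw [e]
      refine (IsUltrametricDist.norm_add_le_max _ _).trans (max_le (happr _ _) ?_)
      rw [norm_neg]
      exact happr _ _
    rw [hz, Nat.cast_add, neg_add, zpow_add₀ hp0.ne', mul_le_mul_iff_right₀ (by positivity)] at h3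
    have h4 : ‖((((t : ℕ) : ℤ) - ((t' : ℕ) : ℤ) : ℤ) : ℚ_[p])‖ ≤ (p : ℝ) ^ (-s : ℤ) := by
      push_cast
      exact h3
    rw [Padic.norm_int_le_pow_iff_dvd] at h4
    have h5 : (t' : ℕ) % p ^ s = (t : ℕ) % p ^ s :=
      (Nat.modEq_iff_dvd (n := p ^ s)).mpr (by exact_mod_cast h4)
    rw [Nat.mod_eq_of_lt t.2, Nat.mod_eq_of_lt t'.2] at h5
    exact Fin.ext h5.symm
  obtain ⟨t, ht⟩ := Finite.injective_iff_surjective.mp hf ⟨0, by positivity⟩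
  have h1 : (z t).appr (l + s) / p ^ l = 0 := congrArg Fin.val ht
  refine ⟨(z 0).appr l, PadicInt.appr_lt _ _, t, t.2, ?_⟩
  rw [← hmod t, Nat.mod_eq_of_lt ((Nat.div_eq_zero_iff_lt (by positivity)).mp h1)]
  exact happr _ _

theorem exists_int_form_small {V : ℕ → Fin 2 → ℤ_[p]} (hV : ∀ t, IsPrimitiveVec (V t)) {l s : ℕ}
    (hl : 0 < l)
    (hw : ∀ t t', ‖wedge (V t) (V t')‖ = (p : ℝ) ^ (-l : ℤ) * ‖(t : ℚ_[p]) - t'‖) :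
    ∃ a b : ℤ, (a, b) ≠ (0, 0) ∧ max ((a : ℝ) ^ 2) ((b : ℝ) ^ 2) < ((p : ℝ) ^ l) ^ 2 ∧
      ∃ t < p ^ s, ‖(a : ℤ_[p]) * V t 0 + b * V t 1‖ ≤ (p : ℝ) ^ (-(l + s : ℕ) : ℤ) := by
  have hp1 : (1 : ℝ) < p := mod_cast (Fact.out : p.Prime).one_lt
  have hlt (t t' : ℕ) : ‖wedge (V t) (V t')‖ < 1 := by
    rw [hw]
    calc (p : ℝ) ^ (-l : ℤ) * ‖(t : ℚ_[p]) - t'‖ ≤ (p : ℝ) ^ (-l : ℤ) := by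
          refine mul_le_of_le_one_right (by positivity) ?_
          exact_mod_cast Padic.norm_int_le_one (p := p) ((t : ℤ) - t')
      _ < 1 := zpow_lt_one_of_neg₀ hp1 (by omega)
  have hpl : 1 < (p : ℝ) ^ l := one_lt_pow₀ hp1 hl.ne'
  have hmax (c : ℕ) (hc : c < p ^ l) : max ((c : ℝ) ^ 2) ((-1 : ℝ) ^ 2) < ((p : ℝ) ^ l) ^ 2 := by
    have hc' : (c : ℝ) < (p : ℝ) ^ l := by exact_mod_cast hc
    refine max_lt (by gcongr) ?_
    rw [neg_one_sq]
    exact one_lt_pow₀ hpl two_ne_zero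
  have unit_of (i j : Fin 2) (hij : ∀ v w : Fin 2 → ℤ_[p],
      ‖wedge v w‖ = ‖v i * w j - v j * w i‖)
      (hprim : ∀ t, ‖V t i‖ = 1 ∨ ‖V t j‖ = 1) (h0 : ‖V 0 i‖ = 1) :
      ∃ c < p ^ l, ∃ t < p ^ s,
        ‖(c : ℤ_[p]) * V t i + (-1 : ℤ) * V t j‖ ≤ (p : ℝ) ^ (-(l + s : ℕ) : ℤ) := by
    -- All determinants have norm below 1, so the vectors define the same point mod `p` and one
    -- coordinate is a unit for all of them. This is where `0 < l` enters.
    have hunit (t : ℕ) : ‖V t i‖ = 1 := by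
      by_contra hne
      have h1 : ‖V t i‖ < 1 := lt_of_le_of_ne (PadicInt.norm_le_one _) hne
      have h2 : ‖V t j‖ = 1 := (hprim t).resolve_left hne
      have h3 := hlt 0 t
      rw [hij] at h3
      have h4 : ‖V 0 i * V t j‖ < 1 := by
        have e : V 0 i * V t j = (V 0 i * V t j - V 0 j * V t i) + V 0 j * V t i := by ring
        rw [e]
        exact PadicInt.norm_lt_one_add h3 (PadicInt.norm_lt_one_mul h1)
      rw [norm_mul, h0, h2] at h4
      norm_num at h4
    choose u hu using fun t => PadicInt.isUnit_iff.mpr (hunit t)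
    have hu1 (t : ℕ) : V t i * ((u t)⁻¹ : ℤ_[p]ˣ) = 1 := by rw [← hu t, Units.mul_inv]
    have hun (t : ℕ) : ‖(((u t)⁻¹ : ℤ_[p]ˣ) : ℤ_[p])‖ = 1 := PadicInt.norm_units _
    obtain ⟨c, hc, t, ht, h⟩ := exists_norm_sub_natCast_le (p := p) (l := l) (s := s)
      (z := fun t => V t j * ((u t)⁻¹ : ℤ_[p]ˣ)) (fun t t' => by
        rw [← hw, hij, norm_sub_rev]
        have e : V t i * V t' j - V t j * V t' i = (V t i * V t' i) *
            (V t' j * ((u t')⁻¹ : ℤ_[p]ˣ) - V t j * ((u t)⁻¹ : ℤ_[p]ˣ)) := by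
          linear_combination (V t j * V t' i) * hu1 t - (V t i * V t' j) * hu1 t'
        rw [e, norm_mul, norm_mul, hunit, hunit, one_mul, one_mul])
    refine ⟨c, hc, t, ht, ?_⟩
    have e : (c : ℤ_[p]) * V t i + (-1 : ℤ) * V t j =
        -(V t i * (V t j * ((u t)⁻¹ : ℤ_[p]ˣ) - c)) := by
      push_cast
      linear_combination (V t j) * hu1 t
    rw [e, norm_neg, norm_mul, hunit, one_mul]
    exact h
  rcases hV 0 with h0 | h0
  · obtain ⟨c, hc, t, ht, h⟩ := unit_of 0 1 (fun _ _ => rfl) hV h0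
    refine ⟨c, -1, by simp, by simpa using hmax c hc, t, ht, by simpa using h⟩
  · obtain ⟨c, hc, t, ht, h⟩ := unit_of 1 0
      (fun v w => by rw [← norm_neg, wedge]; congr 1; ring) (fun t => (hV t).symm) h0
    refine ⟨-1, c, by simp, by rw [max_comm]; simpa using hmax c hc, t, ht, ?_⟩
    rw [add_comm]
    simpa using h

end Pigeonhole

end

/-! ### Separation along the orbit of the transpose -/

noncomputable section

section Orbit

variable {p : ℕ} [Fact p.Prime]

/-- The inclusion `ℤ_p → ℚ̄_p`. -/
def intToAlgCl (p : ℕ) [Fact p.Prime] : ℤ_[p] →+* PadicAlgCl p :=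
  (algebraMap ℚ_[p] (PadicAlgCl p)).comp PadicInt.Coe.ringHom

theorem norm_intToAlgCl (x : ℤ_[p]) : ‖intToAlgCl p x‖ = ‖x‖ := by
  change ‖algebraMap ℚ_[p] (PadicAlgCl p) (x : ℚ_[p])‖ = _
  rw [norm_algebraMap', PadicInt.norm_def]

theorem algClEnd_apply (A : Matrix.GeneralLinearGroup (Fin 2) ℤ_[p]) (u : Fin 2 → PadicAlgCl p) :
    algClEnd A u = ((A : Matrix (Fin 2) (Fin 2) ℤ_[p]).map (intToAlgCl p)).mulVec u := by
  rw [algClEnd, Matrix.toLin'_apply]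
  rfl

theorem IsPrimitiveVec.projDist_point {v : Fin 2 → ℤ_[p]} (hv : IsPrimitiveVec v)
    (w : ProjLine (PadicAlgCl p)) :
    projDist (projToAlgCl p hv.point) w =
      ‖wedge (intToAlgCl p ∘ v) w.rep‖ / vecHeight w.rep := by
  have hH : vecHeight (vecToAlgCl p (vecToPadic v)) = 1 := by
    rw [← hv.vecHeight_eq]
    simp [vecHeight, vecToAlgCl]
  conv_lhs => rw [← w.mk_rep]
  rw [IsPrimitiveVec.point, projToAlgCl, Projectivization.map_mk, projDist_mk, hH, one_mul]
  rfl

/-- The factor 2 in `2 * κ` absorbs the sign of the determinant. Replacing `lam` by the other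
eigenvalue only exchanges the roles of the two inverse powers. -/
theorem norm_wedge_pow_mulVec {A : Matrix.GeneralLinearGroup (Fin 2) ℤ_[p]} {κ : ℕ}
    (hA : A ∈ SLpm p) {w₁ w₂ : ProjLine (PadicAlgCl p)} (hw : w₁ ≠ w₂)
    (hw₁ : IsEigenpoint (glTranspose A) w₁) (hw₂ : IsEigenpoint (glTranspose A) w₂)
    {lam : PadicAlgCl p} (hlam : (algClEnd A).HasEigenvalue lam)
    (hnear : ‖lam ^ (4 * κ) - 1‖ ≤ 1 / 3) {v : Fin 2 → ℤ_[p]} (hv : IsPrimitiveVec v) (t s : ℕ) :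
    ‖wedge (((A : Matrix (Fin 2) (Fin 2) ℤ_[p]).transpose ^ (2 * κ * t)).mulVec v)
        (((A : Matrix (Fin 2) (Fin 2) ℤ_[p]).transpose ^ (2 * κ * s)).mulVec v)‖ =
      projDist (projToAlgCl p hv.point) w₁ * projDist (projToAlgCl p hv.point) w₂ *
        ‖lam ^ (4 * κ) - 1‖ / projDist w₁ w₂ * ‖(t : ℚ_[p]) - s‖ := by
  obtain ⟨μ₁, h₁⟩ := hw₁
  obtain ⟨μ₂, h₂⟩ := hw₂
  obtain ⟨e, he⟩ := hlam.exists_hasEigenvector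
  have h₁' := h₁.apply_eq_smul
  have h₂' := h₂.apply_eq_smul
  have he' := he.apply_eq_smul
  rw [algClEnd_apply] at h₁' h₂' he'
  have hW := wedge_rep_ne_zero hw
  set φ := intToAlgCl p
  set M : Matrix (Fin 2) (Fin 2) ℤ_[p] := (A : Matrix (Fin 2) (Fin 2) ℤ_[p]).transpose
  change (M.map φ).mulVec _ = _ at h₁' h₂'
  obtain ⟨hdet, htr⟩ := det_eq_mul_of_mulVec_eq_smul h₁' h₂' hW
  have hMt : M.map φ = ((A : Matrix (Fin 2) (Fin 2) ℤ_[p]).map φ).transpose := rfl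
  have hroot := sq_sub_trace_mul_add_det_eq_zero he' he.2
  rw [← Matrix.det_transpose, ← Matrix.trace_transpose, ← hMt, hdet, htr] at hroot
  -- `A` and its transpose have the same trace and determinant, hence the same characteristic
  -- polynomial.
  have hlam' : lam = μ₁ ∨ lam = μ₂ := by
    have : (lam - μ₁) * (lam - μ₂) = 0 := by linear_combination hroot
    exact (mul_eq_zero.mp this).imp sub_eq_zero.mp sub_eq_zero.mp
  have hdet2 : (μ₁ * μ₂) ^ 2 = 1 := by
    rw [← hdet, show M.map φ = φ.mapMatrix M from rfl, ← RingHom.map_det, ← map_pow,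
      Matrix.det_transpose]
    rcases hA with h | h <;> rw [h] <;> simp
  have hPQ : μ₁ ^ (2 * κ) * μ₂ ^ (2 * κ) = 1 := by rw [← mul_pow, pow_mul, hdet2, one_pow]
  have e4 (μ : PadicAlgCl p) : (μ ^ (2 * κ)) ^ 2 = μ ^ (4 * κ) := by rw [← pow_mul]; congr 1; ring
  have hdiff : ‖μ₁ ^ (2 * κ * s) * μ₂ ^ (2 * κ * t) - μ₁ ^ (2 * κ * t) * μ₂ ^ (2 * κ * s)‖ =
      ‖(t : ℚ_[p]) - s‖ * ‖lam ^ (4 * κ) - 1‖ := by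
    rcases hlam' with rfl | rfl
    · rw [← e4] at hnear ⊢
      rw [← norm_pow_mul_pow_sub hPQ hnear, norm_sub_rev]
      simp only [pow_mul]
    · rw [← e4] at hnear ⊢
      rw [mul_comm] at hPQ
      rw [← norm_pow_mul_pow_sub hPQ hnear]
      simp only [pow_mul]
      congr 1
      ring
  have hmap (i : ℕ) : ((M.map φ) ^ i).mulVec (φ ∘ v) = φ ∘ ((M ^ i).mulVec v) := by
    ext j
    rw [Function.comp_apply, RingHom.map_mulVec, Matrix.map_pow]
  have main := wedge_mul_wedge_pow_mulVec h₁' h₂' hW (φ ∘ v) (2 * κ * t) (2 * κ * s)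
  rw [hmap, hmap] at main
  have hn := congrArg norm main
  rw [norm_mul, norm_mul, norm_mul, hdiff] at hn
  have hφ : ‖wedge ((M ^ (2 * κ * t)).mulVec v) ((M ^ (2 * κ * s)).mulVec v)‖ =
      ‖wedge (φ ∘ (M ^ (2 * κ * t)).mulVec v) (φ ∘ (M ^ (2 * κ * s)).mulVec v)‖ := by
    rw [← norm_intToAlgCl, map_wedge]
    rfl
  rw [hφ, hv.projDist_point, hv.projDist_point, projDist_eq_wedge]
  have hW' := norm_pos_iff.mpr hW
  have hH₁ := vecHeight_pos w₁.rep_nonzero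
  have hH₂ := vecHeight_pos w₂.rep_nonzero
  field_simp
  linear_combination hn

end Orbit

end

/-! ### Choice of the parameters and the contradiction -/

theorem theorem3p3 (p : ℕ) [Fact p.Prime]
    (A : Matrix.GeneralLinearGroup (Fin 2) ℤ_[p])
    (κ : ℕ) (hκ : IsKappa A κ) (hA : MemSLTilde A κ)
    (w₁ w₂ : ProjLine (PadicAlgCl p)) (hw : w₁ ≠ w₂)
    (hw₁ : IsEigenpoint (glTranspose A) w₁) (hw₂ : IsEigenpoint (glTranspose A) w₂)
    (lam : PadicAlgCl p) (hlam : (algClEnd A).HasEigenvalue lam)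
    (N : ℕ) (w : ℕ → ℕ) (hwN : w ∈ boundedWords N) (xp : ProjLine ℚ_[p])
    (ε₁ ε₂ ε₃ δ : ℝ)
    (hε₁ : ε₁ = projDist (projToAlgCl p xp) w₁)
    (hε₂ : ε₂ = projDist (projToAlgCl p xp) w₂)
    (hε₃ : ε₃ = ‖padicLog p (lam ^ (4 * κ))‖)
    (hδ : δ = min (min ε₁ ε₂) (p : ℝ)⁻¹) (hδ0 : δ ≠ 0)
    (m k : ℕ) (hm : 0 < m)
    (hpk : √(projDist w₁ w₂ * m) / (ε₃ * δ * √(2 * ε₁ * ε₂ * p * κ)) ≤ (p : ℝ) ^ k)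
    (horbit : ∀ j ≤ m, toPadicGL (glTranspose A) ^ j • xp ∈ orbitNhd p k (w, xp)) :
    (w, xp) ∉ LMad p
      √((2 * ε₁ * ε₂ * p * κ) / (ε₃ ^ 2 * δ ^ 2 * projDist w₁ w₂ * m)) := by
  intro hmad
  obtain ⟨v, hv, rfl⟩ := exists_isPrimitiveVec_point_eq xp
  have hp : (1 : ℝ) < p := mod_cast (Fact.out : p.Prime).one_lt
  have hp0 : (0 : ℝ) < p := by linarith
  obtain ⟨hκ0, -, hκ⟩ := hκ
  have hκ0' : (0 : ℝ) < κ := mod_cast hκ0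
  have hm' : (0 : ℝ) < m := mod_cast hm
  obtain ⟨hnear, hne⟩ := norm_pow_four_sub_one_le (hκ lam hlam)
  rw [← pow_mul, mul_comm κ 4] at hnear hne
  rw [norm_padicLog hnear] at hε₃
  have hε₃0 : 0 < ε₃ := by
    rw [hε₃, norm_pos_iff, sub_ne_zero]
    exact hne (hA.2 lam hlam)
  have hε₃1 : ε₃ ≤ 1 := by rw [hε₃]; linarith
  have hd := projDist_pos hw
  have hdmax := projDist_le_max (projToAlgCl p hv.point) w₁ w₂
  have hW := norm_wedge_pow_mulVec (κ := κ) hA.1.1 hw hw₁ hw₂ hlam hnear hv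
  have hε₁0 : 0 ≤ ε₁ := hε₁ ▸ projDist_nonneg _ _
  have hε₂0 : 0 ≤ ε₂ := hε₂ ▸ projDist_nonneg _ _
  rw [← hε₁, ← hε₂] at hdmax hW
  rw [← hε₃] at hW
  set d := projDist w₁ w₂
  have hδpos : 0 < δ := lt_of_le_of_ne (by rw [hδ]; positivity) hδ0.symm
  have hδ₁ : δ ≤ ε₁ := by rw [hδ]; exact (min_le_left _ _).trans (min_le_left _ _)
  have hδ₂ : δ ≤ ε₂ := by rw [hδ]; exact (min_le_left _ _).trans (min_le_right _ _)
  have hδp : δ ≤ (p : ℝ)⁻¹ := by rw [hδ]; exact min_le_right _ _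
  have hε₁0 : 0 < ε₁ := by linarith
  have hε₂0 : 0 < ε₂ := by linarith
  set ε := √((2 * ε₁ * ε₂ * p * κ) / (ε₃ ^ 2 * δ ^ 2 * d * m)) with hε
  have hεpos : 0 < ε := Real.sqrt_pos.mpr (by positivity)
  have hεsq : ε ^ 2 * (ε₃ ^ 2 * δ ^ 2 * d * m) = 2 * ε₁ * ε₂ * p * κ := by
    rw [hε, Real.sq_sqrt (by positivity)]
    field_simp
  -- The form `(1, 0)` takes normalised values at most 1, so a badly approximable point forces this
  -- bound.
  have hε1 : ε ≤ 1 := by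
    have h := (hmad 0).2 1 0 (by simp)
    have hH := vecHeight_pos hv.point.rep_nonzero
    simp only [Function.iterate_zero, id_eq, Int.cast_one, Int.cast_zero, one_pow, one_mul,
      zero_mul, add_zero] at h
    rw [max_eq_left (by norm_num), div_one] at h
    exact h.trans (div_le_one_of_le₀ (le_max_left _ _) hH.le)
  -- This is exactly the lower bound on `p^k` in the hypothesis, rewritten through `ε`.
  set D : ℝ := 1 / (ε * (ε₃ * δ) ^ 2) with hD
  have hDk : D ≤ (p : ℝ) ^ k := by
    refine le_of_eq_of_le ?_ hpk
    have hεs : ε * (ε₃ * δ * √(d * m)) = √(2 * ε₁ * ε₂ * p * κ) := by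
      have h := congrArg Real.sqrt hεsq
      rw [Real.sqrt_mul (by positivity), Real.sqrt_sq hεpos.le,
        show ε₃ ^ 2 * δ ^ 2 * d * m = (ε₃ * δ) ^ 2 * (d * m) by ring,
        Real.sqrt_mul (by positivity), Real.sqrt_sq (by positivity)] at h
      exact h
    rw [← hεs, hD]
    have : 0 < √(d * m) := Real.sqrt_pos.mpr (by positivity)
    field_simp
  set a := ε₃ * δ with ha
  have ha0 : 0 < a := by positivity
  set ρ := ε₁ * ε₂ * ε₃ / d with hρ
  -- By the ultrametric inequality `d` is at most one of `ε₁, ε₂`, and `δ` is at most the other.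
  have haρ : a ≤ ρ := by
    rw [hρ, le_div_iff₀ hd]
    rcases le_max_iff.mp hdmax with h | h
    · calc a * d ≤ (ε₃ * ε₂) * ε₁ := by rw [ha]; gcongr
        _ = ε₁ * ε₂ * ε₃ := by ring
    · calc a * d ≤ (ε₃ * ε₁) * ε₂ := by rw [ha]; gcongr
        _ = ε₁ * ε₂ * ε₃ := by ring
  -- `ρ` is the norm of a nonzero element of `ℤ_p`, the determinant for `t = 1, s = 0`.
  obtain ⟨l₀, hl₀⟩ : ∃ l₀ : ℕ, ρ = (p : ℝ) ^ (-l₀ : ℤ) := by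
    have h := hW 1 0
    simp only [Nat.cast_one, Nat.cast_zero, sub_zero, norm_one, mul_one] at h
    rw [← h]
    exact ⟨_, PadicInt.norm_eq_zpow_neg_valuation (norm_pos_iff.mp (h ▸ ha0.trans_le haρ))⟩
  have hρl₀ : ρ * (p : ℝ) ^ l₀ = 1 := by
    rw [hl₀, zpow_neg, zpow_natCast, inv_mul_cancel₀ (by positivity)]
  -- The exponent is raised to at least 1, as `exists_int_form_small` requires. The bound `δ ≤ p⁻¹`
  -- pays for this when `l₀ = 0`.
  obtain ⟨l, hl, hl₀l, hla⟩ : ∃ l : ℕ, 0 < l ∧ l₀ ≤ l ∧ (p : ℝ) ^ l * a ≤ 1 := by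
    refine ⟨max l₀ 1, by simp, le_max_left _ _, ?_⟩
    rcases le_total l₀ 1 with h | h
    · rw [max_eq_right h, pow_one]
      calc (p : ℝ) * a ≤ p * (1 * (p : ℝ)⁻¹) := by rw [ha]; gcongr
        _ = 1 := by field_simp
    · rw [max_eq_left h, mul_comm, ← hρl₀]
      gcongr
  have hlD : (p : ℝ) ^ l ≤ D := by
    rw [hD, le_div_iff₀ (by positivity)]
    have ha1 : a ≤ 1 := by
      have := one_le_pow₀ (M₀ := ℝ) hp.le (n := l)
      nlinarith
    calc (p : ℝ) ^ l * (ε * a ^ 2) = ((p : ℝ) ^ l * a) * (ε * a) := by ring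
      _ ≤ 1 * (1 * 1) := by gcongr
      _ = 1 := by norm_num
  -- Take the least `K` with `D ≤ p^K`. Minimality costs only a factor `p`, the one occurring in
  -- `ε`.
  obtain ⟨K, hKk, hDK, hKD⟩ : ∃ K ≤ k, D ≤ (p : ℝ) ^ K ∧ (p : ℝ) ^ K ≤ p * D := by
    classical
    have hex : ∃ n : ℕ, D ≤ (p : ℝ) ^ n := ⟨k, hDk⟩
    refine ⟨Nat.find hex, Nat.find_min' hex hDk, Nat.find_spec hex, ?_⟩
    rcases hn : Nat.find hex with _ | n
    · have := one_le_pow₀ (M₀ := ℝ) hp.le (n := l)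
      rw [pow_zero]
      nlinarith
    · have h := not_le.mp (Nat.find_min hex (m := n) (by omega))
      rw [pow_succ']
      gcongr
  have hlK : l ≤ K := (pow_le_pow_iff_right₀ hp).mp (hlD.trans hDK)
  obtain ⟨s, rfl⟩ := Nat.exists_eq_add_of_le hlK
  obtain ⟨e, rfl⟩ := Nat.exists_eq_add_of_le hl₀l
  have hprim (j : ℕ) :
      IsPrimitiveVec (((A : Matrix (Fin 2) (Fin 2) ℤ_[p]).transpose ^ j).mulVec v) :=
    hv.mulVec (glTranspose A ^ j)
  have hpoint (j : ℕ) : toPadicGL (glTranspose A) ^ j • hv.point = (hprim j).point := by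
    have h := hv.toPadicGL_smul_point (glTranspose A ^ j)
    rw [toPadicGL, map_pow] at h
    exact h
  obtain ⟨b, c, hbc, hmax, t, ht, hform⟩ := exists_int_form_small (s := s)
    -- Stepping by `p^e` scales every determinant by `p^(-e)` and turns `p^(-l₀)` into `p^(-l)`.
    (fun t => hprim (2 * κ * (p ^ e * t))) hl (fun t t' => by
      rw [hW, hl₀]
      push_cast
      rw [← mul_sub, norm_mul, norm_pow, Padic.norm_p, neg_add, zpow_add₀ hp0.ne', zpow_neg,
        zpow_neg, zpow_natCast, zpow_natCast, inv_pow, mul_assoc])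
  have htm : 2 * κ * (p ^ e * t) ≤ m := by
    -- Here `p^e p^s = p^K ρ`, and `2 κ p D ρ = m ε ε₃ ≤ m` by the definition of `ε`.
    have hbound : 2 * κ * ((p : ℝ) ^ (l₀ + e + s) * ρ) ≤ m := by
      rw [hρ, mul_div_assoc', mul_div_assoc', div_le_iff₀ hd]
      have hDa : D * (ε * a ^ 2) = 1 := by rw [hD]; field_simp
      calc 2 * κ * ((p : ℝ) ^ (l₀ + e + s) * (ε₁ * ε₂ * ε₃))
          ≤ 2 * κ * ((p * D) * (ε₁ * ε₂ * ε₃)) := by gcongr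
        _ = (2 * ε₁ * ε₂ * p * κ) * (D * ε₃) := by ring
        _ = (D * (ε * a ^ 2)) * (ε * ε₃) * (m * d) := by rw [← hεsq, ha]; ring
        _ ≤ 1 * (1 * 1) * (m * d) := by rw [hDa]; gcongr
        _ = m * d := by ring
    have hpow : (p : ℝ) ^ (l₀ + e + s) * ρ = (p : ℝ) ^ e * (p : ℝ) ^ s := by
      rw [pow_add, pow_add]
      linear_combination (p : ℝ) ^ e * (p : ℝ) ^ s * hρl₀
    rw [hpow] at hbound
    have h : 2 * κ * (p ^ e * p ^ s) ≤ m := by exact_mod_cast hbound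
    exact (Nat.mul_le_mul_left _ (Nat.mul_le_mul_left _ ht.le)).trans h
  obtain ⟨n, hn⟩ := horbit _ htm
  rw [hpoint] at hn
  have hr : ((p : ℝ) ^ k)⁻¹ ≤ (p : ℝ) ^ (-(l₀ + e + s : ℕ) : ℤ) := by
    rw [zpow_neg, zpow_natCast]
    exact inv_anti₀ (by positivity) (pow_le_pow_right₀ hp.le hKk)
  have hsmall := (hprim _).norm_form_div_le (hn.trans hr) hform
  have hbad := ((hmad n).2 b c hbc).trans hsmall
  have hmaxpos : 0 < max ((b : ℝ) ^ 2) ((c : ℝ) ^ 2) := by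
    rcases eq_or_ne b 0 with h | h
    · have : c ≠ 0 := fun hc => hbc (by rw [h, hc])
      exact lt_max_of_lt_right (by positivity)
    · exact lt_max_of_lt_left (by positivity)
  have hupper : (p : ℝ) ^ (-(l₀ + e + s : ℕ) : ℤ) ≤ ε * a ^ 2 := by
    rw [zpow_neg, zpow_natCast, inv_le_comm₀ (by positivity) (by positivity), ← one_div]
    exact hDK
  refine absurd (hbad.trans hupper) (not_le.mpr ?_)
  rw [lt_div_iff₀ hmaxpos]
  calc ε * a ^ 2 * max ((b : ℝ) ^ 2) ((c : ℝ) ^ 2)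
      < ε * a ^ 2 * ((p : ℝ) ^ (l₀ + e)) ^ 2 := by gcongr
    _ = ε * ((p : ℝ) ^ (l₀ + e) * a) ^ 2 := by ring
    _ ≤ ε * 1 ^ 2 := by gcongr
    _ = ε := by ring
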